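/- **Theorem 3.1.** Let $m\ge 2$ be even and $n\ge 1$. For a real tensor $\mathcal T=(t_{i_1\cdots i_m})$ of order $m$ with indices in a finite set $I$, write $\mathcal T\mathbf x^m=\sum_{i_1,\dots,i_m\in I}t_{i_1\cdots i_m}x_{i_1}\cdots x_{i_m}$; the entries $t_{i\cdots i}$ are called diagonal, all others off-diagonal; $\mathcal T$ is symmetric if its entries are invariant under permutations of their indices. For $\Gamma\subseteq[n]=\{1,\dots,n\}$ let $\mathbf x_\Gamma=(x_i)_{i\in\Gamma}$. Let $\mathcal A$ be a symmetric real tensor of order $m$ and dimension $n$ which is a $W$-tensor, i.e. there are $1\le s\le n$, pairwise distinct sets $\Gamma_1,\dots,\Gamma_s\subseteq[n]$ with $\bigcup_{l=1}^s\Gamma_l=[n]$, and real tensors $\mathcal A_{\Gamma_l}$ of order $m$ with indices in $\Gamma_l$ ($1\le l\le s$), such that 1. $\bigl|\bigl(\bigcup_{l=1}^{p-1}\Gamma_l\bigr)\cap\Gamma_p\bigr|\le 1$ for all $2\le p\le s$; 2. $\mathcal A\mathbf x^m=\sum_{l=1}^s\mathcal A_{\Gamma_l}\mathbf x_{\Gamma_l}^m$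 for all $\mathbf x\in\mathbb R^n$; 3. for each $l$, either (a) there is a multi-index $(j_1,\dots,j_m)\in\Gamma_l^m$, not all of whose components are equal, such that every off-diagonal entry of $\mathcal A_{\Gamma_l}$ whose multi-index is not a permutation of $(j_1,\dots,j_m)$ is zero, or (b) all off-diagonal entries of $\mathcal A_{\Gamma_l}$ are nonnegative. Fix any such $s$, $\Gamma_l$ and $\mathcal A_{\Gamma_l}$, let $f(\mathbf x)=-\mathcal A\mathbf x^m$, and suppose that $f(\mathbf x)\ge 0$ for all $\mathbf x\in\mathbb R^n$. Then there exist polynomials $h_l\in\mathbb R[\mathbf x_{\Gamma_l}]$ ($1\le l\le s$) and real numbers $\rho_i^l$ ($1\le i\le n$, $1\le l\le s$) such that each $h_l$ is a sum of squares of polynomials in $\mathbb R[\mathbf x_{\Gamma_l}]$, $$h_l(\mathbf x_{\Gamma_l})=-\mathcal A_{\Gamma_l}\mathbf x_{\Gamma_l}^m+\sum_{i\in\Gamma_l}\rho_i^l x_i^m\quad(1\le l\le s),\qquad \sum_{l:\,i\in\Gamma_l}\rho_i^l=0\quad(1\le i\le n),$$ and $$f(\mathbf x)=h_1(\mathbf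 x_{\Gamma_1})+\cdots+h_s(\mathbf x_{\Gamma_s}).$$ -/

import Mathlib

/-- A real tensor of order `m` with index set `ι` (dimension `|ι|`): a family of real entries
`a_{i_1 ⋯ i_m}` with `i_1, …, i_m ∈ ι`. -/
abbrev RealTensor (m : ℕ) (ι : Type*) : Type _ := (Fin m → ι) → ℝ

namespace RealTensor

/-- The entries are invariant under every permutation of their indices. -/
def IsSymmetric {m : ℕ} {ι : Type*} (A : RealTensor m ι) : Prop :=
  ∀ (σ : Equiv.Perm (Fin m)) (i : Fin m → ι), A (i ∘ σ) = A i

/-- The polynomial `A x^m = ∑ a_{i_1 ⋯ i_m} x_{i_1} ⋯ x_{i_m}` in the variables `x_i`, `i ∈ ι`. -/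
noncomputable def form {m : ℕ} {ι : Type*} [Fintype ι] (A : RealTensor m ι) :
    MvPolynomial ι ℝ :=
  ∑ i : Fin m → ι, MvPolynomial.C (A i) * ∏ k : Fin m, MvPolynomial.X (i k)

/-- The multi-index `(i_1, …, i_m)` is off-diagonal: it is not of the form `(a, …, a)`. -/
def OffDiag {m : ℕ} {ι : Type*} (i : Fin m → ι) : Prop := ¬ ∃ a : ι, ∀ k : Fin m, i k = a

/-- All off-diagonal entries vanish, except possibly those at the permutations of one single
off-diagonal multi-index. -/
def HasSingleMixedTerm {m : ℕ} {ι : Type*} (A : RealTensor m ι) : Prop :=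
  ∃ j : Fin m → ι, OffDiag j ∧
    ∀ i : Fin m → ι, OffDiag i → (¬ ∃ σ : Equiv.Perm (Fin m), i = j ∘ σ) → A i = 0

/-- All off-diagonal entries are nonnegative. -/
def IsEssentiallyNonneg {m : ℕ} {ι : Type*} (A : RealTensor m ι) : Prop :=
  ∀ i : Fin m → ι, OffDiag i → 0 ≤ A i

/-- `A` is a W-tensor, as witnessed by the index sets `Γ_1, …, Γ_s` (numbered from `0` here) and by
the blocks `A_{Γ_l}`, where `B l` is a tensor of order `m` whose indices run over `Γ_l`. -/
structure IsWTensorWith {m n s : ℕ} (A : RealTensor m (Fin n)) (Γ : Fin s → Finset (Fin n))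
    (B : (l : Fin s) → RealTensor m (Γ l)) : Prop where
  one_le : 1 ≤ s
  le_dim : s ≤ n
  cover : ∀ i : Fin n, ∃ l : Fin s, i ∈ Γ l
  distinct : Function.Injective Γ
  /-- Each set meets the union of the preceding ones in at most one index (for the first set this
  says nothing, as the union is then empty). -/
  inter_le_one : ∀ p : Fin s, ((Finset.Iio p).biUnion Γ ∩ Γ p).card ≤ 1
  /-- `A x^m = ∑ A_{Γ_l} x_{Γ_l}^m` for all real vectors `x`. -/
  decomp : ∀ x : Fin n → ℝ, MvPolynomial.eval x A.form =
    ∑ l : Fin s, MvPolynomial.eval (fun i : Γ l => x i) (B l).form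
  block : ∀ l : Fin s, HasSingleMixedTerm (B l) ∨ IsEssentiallyNonneg (B l)

/-- `A` is a W-tensor. -/
def IsWTensor {m n : ℕ} (A : RealTensor m (Fin n)) : Prop :=
  ∃ (s : ℕ) (Γ : Fin s → Finset (Fin n)) (B : (l : Fin s) → RealTensor m (Γ l)),
    IsWTensorWith A Γ B

end RealTensor

/-! Write `f` as a diagonal form `∑ d_v x_v^m` minus mixed terms grouped by block, a block of type
(a) contributing a single monomial. If all mixed coefficients `b_a` are nonnegative, the diagonal
can be shared out among the monomials so that each share satisfies the AM-GM condition `b_a^m ≤ m^m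
∏ c_{a,k}` (`exists_weights`). Hurwitz's identities then make each share minus its monomial a sum of
squares (`isSumSq_sum_mul_pow_add_mul_prod`). Collecting the shares by block gives `h_l`, and `ρ`
records the diagonal mass moved between blocks.

Negative mixed coefficients occur only in blocks with one mixed monomial. The intersection condition
gives a retraction that fixes such a block and collapses every other block to a point
(`exists_retraction`). The rest of `f` is unchanged by sign flips on its fibres and additive over
them. So the coefficient `β < 0` can be replaced by `|β|`, or by `0` if all exponents are even (then
the monomial is a square), and the form stays nonnegative (`exists_isMajorant`). -/

/-! ### AM-GM inequalities as sums of squares. -/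

theorem IsSumSq.of_eq {R : Type*} [CommRing R] {a b : R} (h : IsSumSq a) (e : b = a) :
    IsSumSq b :=
  e ▸ h

theorem IsSumSq.algebraMap_mul {R : Type*} [CommRing R] [Algebra ℝ R] {a : R} (c : ℝ)
    (hc : 0 ≤ c) (ha : IsSumSq a) : IsSumSq (algebraMap ℝ R c * a) := by
  have : algebraMap ℝ R c = algebraMap ℝ R (√c) * algebraMap ℝ R (√c) := by
    rw [← map_mul, Real.mul_self_sqrt hc]
  rw [this]
  exact (IsSumSq.mul_self _).mul ha

/-- The product is `(a - b)^2` times a geometric sum of monomials in `a` and `b`. -/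
theorem IsSumSq.mul_sub_pow_sub_pow {R : Type*} [CommRing R] {a b : R} (ha : IsSumSq a)
    (hb : IsSumSq b) (j : ℕ) : IsSumSq ((a - b) * (a ^ j - b ^ j)) := by
  have hpow : ∀ {x : R}, IsSumSq x → ∀ i : ℕ, IsSumSq (x ^ i) := by
    intro x hx i
    induction i with
    | zero => simp
    | succ i ih => rw [pow_succ]; exact ih.mul hx
  have h := (Commute.all a b).geom_sum₂_mul j
  rw [← h, show (a - b) * ((∑ i ∈ Finset.range j, a ^ i * b ^ (j - 1 - i)) * (a - b)) =
    ((a - b) * (a - b)) * ∑ i ∈ Finset.range j, a ^ i * b ^ (j - 1 - i) by ring]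
  exact (IsSumSq.mul_self _).mul (IsSumSq.sum fun i _ => (hpow ha i).mul (hpow hb _))

/-- Hurwitz's form of the inequality of arithmetic and geometric means for sums of squares. -/
theorem isSumSq_sum_pow_sub_card_mul_prod {R ι : Type*} [CommRing R] [Algebra ℝ R]
    [DecidableEq ι] {u : ι → R} (hu : ∀ i, IsSumSq (u i)) (p : ℕ) (s : Finset ι)
    (hs : s.card = p) : IsSumSq (∑ k ∈ s, u k ^ p - p * ∏ k ∈ s, u k) := by
  induction p generalizing s with
  | zero => simp [Finset.card_eq_zero.1 hs]
  | succ p ih =>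
    rcases Nat.eq_zero_or_pos p with rfl | hp
    · obtain ⟨a, rfl⟩ := Finset.card_eq_one.1 hs
      simp
    have h1 : IsSumSq (∑ k ∈ s, u k * (∑ j ∈ s.erase k, u j ^ p - p * ∏ j ∈ s.erase k, u j)) :=
      IsSumSq.sum fun k hk => (hu k).mul (ih _ (by rw [Finset.card_erase_of_mem hk, hs]; rfl))
    have h2 : IsSumSq (∑ k ∈ s, ∑ j ∈ s, (u k - u j) * (u k ^ p - u j ^ p)) :=
      IsSumSq.sum fun k _ => IsSumSq.sum fun j _ => (hu k).mul_sub_pow_sub_pow (hu j) p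
    have e1 : ∑ k ∈ s, u k * (∑ j ∈ s.erase k, u j ^ p - p * ∏ j ∈ s.erase k, u j) =
        ∑ k ∈ s, ∑ j ∈ s, u k * u j ^ p - ∑ k ∈ s, u k ^ (p + 1) -
          (p + 1) * p * ∏ j ∈ s, u j := by
      have : ∀ k ∈ s, u k * (∑ j ∈ s.erase k, u j ^ p - p * ∏ j ∈ s.erase k, u j) =
          ∑ j ∈ s, u k * u j ^ p - u k ^ (p + 1) - p * ∏ j ∈ s, u j := by
        intro k hk
        rw [← Finset.mul_prod_erase s u hk, ← Finset.mul_sum, ← Finset.add_sum_erase s _ hk]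
        ring
      rw [Finset.sum_congr rfl this]
      simp only [Finset.sum_sub_distrib, Finset.sum_const, hs, nsmul_eq_mul]
      push_cast
      ring
    have e2 : ∑ k ∈ s, ∑ j ∈ s, (u k - u j) * (u k ^ p - u j ^ p) =
        2 * ((p + 1) * ∑ k ∈ s, u k ^ (p + 1) - ∑ k ∈ s, ∑ j ∈ s, u k * u j ^ p) := by
      have : ∀ k ∈ s, ∀ j ∈ s, (u k - u j) * (u k ^ p - u j ^ p) =
          u k ^ (p + 1) + u j ^ (p + 1) - u k * u j ^ p - u j * u k ^ p := by
        intros; ring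
      rw [Finset.sum_congr rfl fun k hk => Finset.sum_congr rfl (this k hk)]
      have hcomm : ∑ k ∈ s, ∑ j ∈ s, u j * u k ^ p = ∑ k ∈ s, ∑ j ∈ s, u k * u j ^ p :=
        Finset.sum_comm
      simp only [Finset.sum_sub_distrib, Finset.sum_add_distrib, Finset.sum_const, hs,
        nsmul_eq_mul, ← Finset.mul_sum, hcomm] at *
      push_cast
      ring
    have hp' : (p : ℝ) ≠ 0 := by positivity
    have hcan : algebraMap ℝ R (1 / p) * (p : R) = 1 := by
      rw [← map_natCast (algebraMap ℝ R), ← map_mul, one_div, inv_mul_cancel₀ hp', map_one]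
    have h2can : algebraMap ℝ R (1 / 2) * 2 = 1 := by
      rw [← map_ofNat (algebraMap ℝ R) 2, ← map_mul]; norm_num
    -- The double sums `∑ u_k u_j^p` cancel in `h1 + h2 / 2`, which leaves `p` times the claim.
    have h3 := ((h2.algebraMap_mul (1 / 2) (by norm_num)).add h1).algebraMap_mul
      (1 / p) (by positivity)
    refine h3.of_eq ?_
    rw [e1, e2]
    push_cast
    linear_combination (-(∑ k ∈ s, u k ^ (p + 1) - (p + 1) * ∏ k ∈ s, u k)) * hcan -
      algebraMap ℝ R (1 / p) * ((p + 1) * ∑ k ∈ s, u k ^ (p + 1) -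
        ∑ k ∈ s, ∑ j ∈ s, u k * u j ^ p) * h2can

/-- For `m = 2p`, apply Hurwitz to the squares of each half of the variables, with half-products `P`
and `Q`; then `p P^2 + p Q^2 - 2p P Q = p (P - Q)^2`. -/
theorem isSumSq_sum_pow_sub_mul_prod {R : Type*} [CommRing R] [Algebra ℝ R] {m : ℕ}
    (hm : Even m) (y : Fin m → R) : IsSumSq (∑ k, y k ^ m - m * ∏ k, y k) := by
  obtain ⟨p, rfl⟩ := hm
  have key : ∀ z : Fin p → R, IsSumSq (∑ k, z k ^ (p + p) - p * (∏ k, z k) ^ 2) := by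
    intro z
    have := isSumSq_sum_pow_sub_card_mul_prod (u := fun k => z k * z k)
      (fun k => IsSumSq.mul_self _) p Finset.univ (by simp)
    simpa [← pow_two, ← pow_mul, ← two_mul, Finset.prod_pow] using this
  rw [Fin.sum_univ_add, Fin.prod_univ_add]
  set P := ∏ i : Fin p, y (Fin.castAdd p i)
  set Q := ∏ i : Fin p, y (Fin.natAdd p i)
  have h := ((key fun i => y (Fin.castAdd p i)).add (key fun i => y (Fin.natAdd p i))).add
    ((IsSumSq.natCast p).mul (IsSumSq.mul_self (P - Q)))
  refine h.of_eq ?_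
  simp only [P, Q]
  push_cast
  ring

/-- A diagonal form plus one mixed term is a sum of squares as soon as the coefficients satisfy the
inequality forced by nonnegativity. -/
theorem isSumSq_sum_mul_pow_add_mul_prod {R : Type*} [CommRing R] [Algebra ℝ R] {m : ℕ}
    (hm0 : 0 < m) (hm : Even m) (y : Fin m → R) (c : Fin m → ℝ) (hc : ∀ k, 0 ≤ c k) (b : ℝ)
    (hb : |b| ^ m ≤ m ^ m * ∏ k, c k) :
    IsSumSq (∑ k, algebraMap ℝ R (c k) * y k ^ m + algebraMap ℝ R b * ∏ k, y k) := by
  set r : Fin m → ℝ := fun k => c k ^ ((m : ℝ)⁻¹)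
  have hr : ∀ k, r k ^ m = c k := fun k => Real.rpow_inv_natCast_pow (hc k) hm0.ne'
  have hr0 : ∀ k, 0 ≤ r k := fun k => Real.rpow_nonneg (hc k) _
  set M : ℝ := m * ∏ k, r k
  have hM0 : 0 ≤ M := mul_nonneg (Nat.cast_nonneg _) (Finset.prod_nonneg fun k _ => hr0 k)
  have hbM : |b| ≤ M := by
    refine le_of_pow_le_pow_left₀ hm0.ne' hM0 (hb.trans_eq ?_)
    simp only [M, mul_pow, ← Finset.prod_pow, hr]
  have hminus : IsSumSq (∑ k, algebraMap ℝ R (c k) * y k ^ m - algebraMap ℝ R M * ∏ k, y k) := by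
    have := isSumSq_sum_pow_sub_mul_prod hm fun k => algebraMap ℝ R (r k) * y k
    convert this using 2
    · simp [mul_pow, ← map_pow, hr]
    · simp [M, Finset.prod_mul_distrib, map_prod, mul_assoc]
  -- Flipping the sign of one variable changes the product but no even power.
  have hplus : IsSumSq (∑ k, algebraMap ℝ R (c k) * y k ^ m + algebraMap ℝ R M * ∏ k, y k) := by
    have := isSumSq_sum_pow_sub_mul_prod hm fun k =>
      (if k = ⟨0, hm0⟩ then (-1 : R) else 1) * (algebraMap ℝ R (r k) * y k)
    refine this.of_eq ?_
    rw [Finset.prod_mul_distrib, Finset.prod_ite_eq' Finset.univ, sub_eq_add_neg]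
    congr 1
    · refine Finset.sum_congr rfl fun k _ => ?_
      rw [mul_pow, mul_pow, ← map_pow, hr]
      split_ifs <;> simp [hm.neg_one_pow]
    · simp [M, Finset.prod_mul_distrib, map_prod, mul_assoc]
  rcases eq_or_lt_of_le hM0 with h0 | hMpos
  · have : b = 0 := abs_nonpos_iff.1 (hbM.trans_eq h0.symm)
    rw [← h0] at hplus
    rwa [this]
  obtain ⟨h1, h2⟩ := abs_le.1 hbM
  have h3 := (hplus.algebraMap_mul ((M + b) / (2 * M))
    (div_nonneg (by linarith) (by linarith))).add (hminus.algebraMap_mul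
      ((M - b) / (2 * M)) (div_nonneg (by linarith) (by linarith)))
  refine h3.of_eq ?_
  have e1 : algebraMap ℝ R ((M + b) / (2 * M)) + algebraMap ℝ R ((M - b) / (2 * M)) = 1 := by
    rw [← map_add, ← map_one (algebraMap ℝ R)]; congr 1; field_simp; ring
  have e2 : (algebraMap ℝ R ((M + b) / (2 * M)) - algebraMap ℝ R ((M - b) / (2 * M))) *
      algebraMap ℝ R M = algebraMap ℝ R b := by
    rw [← map_sub, ← map_mul]; congr 1; field_simp; ring
  linear_combination -(∑ k, algebraMap ℝ R (c k) * y k ^ m) * e1 - (∏ k, y k) * e2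

/-! ### Sharing the diagonal among the monomials. -/

/-- A positive point at which the logarithmic gradient of a form with nonnegative coefficients is
dominated by that of the diagonal form. -/
theorem exists_pos_logGradient_le {ι V : Type*} [Fintype ι] [Fintype V] [DecidableEq V] {m : ℕ}
    (hm : 0 < m) (d : V → ℝ) (b : ι → ℝ) (e : ι → Fin m → V)
    (h : ∀ x : V → ℝ, (∀ v, 0 < x v) → ∑ a, b a * ∏ k, x (e a k) ≤ ∑ v, d v * x v ^ m)
    {δ : ℝ} (hδ : 0 < δ) :
    ∃ x : V → ℝ, (∀ v, 0 < x v) ∧ ∀ v,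
      ∑ a, b a * (∏ k, x (e a k)) * (∑ k, if e a k = v then 1 else 0) ≤
        m * (d v + δ) * x v ^ m := by
  -- In coordinates `x = exp t`, the `δ` term forces growth as `t_v → ∞` and `-∑ t_v` as `t_v → -∞`,
  -- so a minimum exists. There the `v`-derivative vanishes, and the linear term contributes the
  -- slack `1`.
  set Ψ : (V → ℝ) → ℝ := fun t => ∑ v, (d v + δ) * Real.exp (m * t v) -
    ∑ a, b a * Real.exp (∑ k, t (e a k)) - ∑ v, t v with hΨ
  have hcont : Continuous Ψ := by fun_prop
  have hg : ∀ t : ℝ, |t| - 2 / δ ≤ δ * Real.exp (m * t) - t := by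
    intro t
    rcases le_total t 0 with ht | ht
    · rw [abs_of_nonpos ht]
      have : 0 < δ * Real.exp (m * t) := by positivity
      have : 0 < 2 / δ := by positivity
      linarith
    · rw [abs_of_nonneg ht]
      have h1 : t ≤ m * t := le_mul_of_one_le_left ht (by exact_mod_cast hm)
      have h2 := Real.quadratic_le_exp_of_nonneg ht
      have h3 : t ^ 2 / 2 ≤ Real.exp (m * t) := by
        have := Real.exp_le_exp.2 h1
        linarith
      have h4 := mul_le_mul_of_nonneg_left h3 hδ.le
      have h5 : 0 ≤ δ * (t - 2 / δ) ^ 2 / 2 := by positivity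
      have h6 : δ * (t - 2 / δ) ^ 2 / 2 = δ * (t ^ 2 / 2) - 2 * t + 2 / δ := by
        field_simp; ring
      linarith
  have hlow : ∀ t, ‖t‖ - Fintype.card V * (2 / δ) ≤ Ψ t := by
    intro t
    have h1 := h (fun v => Real.exp (t v)) fun v => Real.exp_pos _
    simp only [← Real.exp_sum, ← Real.exp_nat_mul] at h1
    have h2 : ∑ v, (|t v| - 2 / δ) ≤ ∑ v, (δ * Real.exp (m * t v) - t v) :=
      Finset.sum_le_sum fun v _ => hg (t v)
    have h3 : ‖t‖ ≤ ∑ v, |t v| :=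
      (pi_norm_le_iff_of_nonneg (Finset.sum_nonneg fun v _ => abs_nonneg _)).2 fun v =>
        Finset.single_le_sum (f := fun v => |t v|) (fun v _ => abs_nonneg _) (Finset.mem_univ v)
    simp only [Finset.sum_sub_distrib, Finset.sum_const, Finset.card_univ, nsmul_eq_mul] at h2
    simp only [hΨ, add_mul, Finset.sum_add_distrib]
    linarith
  obtain ⟨t, ht⟩ := hcont.exists_forall_le' (x₀ := 0) (by
    have h1 : Filter.Tendsto (fun t : V → ℝ => ‖t‖ - Fintype.card V * (2 / δ))
        (Filter.cocompact _) Filter.atTop :=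
      Filter.tendsto_atTop_add_const_right _ _ tendsto_norm_cocompact_atTop
    exact (Filter.tendsto_atTop_mono hlow h1).eventually_ge_atTop _)
  refine ⟨fun v => Real.exp (t v), fun v => Real.exp_pos _, fun v => ?_⟩
  set N : ι → ℝ := fun a => ∑ k, if e a k = v then (1 : ℝ) else 0
  set φ : ℝ → ℝ := fun s => ∑ w, (d w + δ) * Real.exp (m * (t w + s * if w = v then 1 else 0)) -
    ∑ a, b a * Real.exp (∑ k, t (e a k) + s * N a) - (∑ w, t w + s) with hφ
  have hφΨ : ∀ s, φ s = Ψ (fun w => t w + s * if w = v then 1 else 0) := by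
    intro s
    simp only [hφ, hΨ, Finset.sum_add_distrib, ← Finset.mul_sum, N]
    simp
  have hmin : IsLocalMin φ 0 := by
    refine Filter.Eventually.of_forall fun s => ?_
    rw [hφΨ, hφΨ]
    simpa using ht _
  have hder : HasDerivAt φ (∑ w, (d w + δ) * (Real.exp (m * t w) * (m * if w = v then 1 else 0)) -
      ∑ a, b a * (Real.exp (∑ k, t (e a k)) * N a) - 1) 0 := by
    refine ((HasDerivAt.fun_sum fun w _ => ?_).sub (HasDerivAt.fun_sum fun a _ => ?_)).sub
      ((hasDerivAt_id' (0 : ℝ)).const_add _)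
    · have := ((((hasDerivAt_id' (0 : ℝ)).mul_const (if w = v then (1 : ℝ) else 0)).const_add
        (t w)).const_mul (m : ℝ)).exp.const_mul (d w + δ)
      simpa using this
    · have := (((hasDerivAt_id' (0 : ℝ)).mul_const (N a)).const_add
        (∑ k, t (e a k))).exp.const_mul (b a)
      simpa using this
  have h0 := hmin.hasDerivAt_eq_zero hder
  simp only [mul_ite, mul_one, mul_zero, Finset.sum_ite_eq', Finset.mem_univ, if_true] at h0
  simp only [← Real.exp_sum, ← Real.exp_nat_mul]
  have : ∑ a, b a * Real.exp (∑ k, t (e a k)) * (∑ k, if e a k = v then 1 else 0) =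
    ∑ a, b a * (Real.exp (∑ k, t (e a k)) * N a) :=
    Finset.sum_congr rfl fun a _ => by rw [mul_assoc]
  rw [this]
  linarith

/-- The weights are those for which AM-GM is an equality at the point `x` of
`exists_pos_logGradient_le`; the total demanded at `v` is then the logarithmic gradient there
divided by `m x_v^m`. -/
theorem exists_weights_add {ι V : Type*} [Fintype ι] [Fintype V] [DecidableEq V] {m : ℕ}
    (hm : 0 < m) (d : V → ℝ) (b : ι → ℝ) (hb : ∀ a, 0 ≤ b a) (e : ι → Fin m → V)
    (h : ∀ x : V → ℝ, (∀ v, 0 < x v) → ∑ a, b a * ∏ k, x (e a k) ≤ ∑ v, d v * x v ^ m)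
    {δ : ℝ} (hδ : 0 < δ) :
    ∃ c : ι → Fin m → ℝ, (∀ a k, 0 ≤ c a k) ∧ (∀ a, b a ^ m ≤ m ^ m * ∏ k, c a k) ∧
      ∀ v, ∑ a, ∑ k, (if e a k = v then c a k else 0) ≤ d v + δ := by
  obtain ⟨x, hx, hxv⟩ := exists_pos_logGradient_le hm d b e h hδ
  have hm' : (0 : ℝ) < m := by exact_mod_cast hm
  have hP : ∀ a, 0 < ∏ k, x (e a k) := fun a => Finset.prod_pos fun k _ => hx _
  refine ⟨fun a k => b a * (∏ k, x (e a k)) / (m * x (e a k) ^ m), fun a k => ?_, fun a => ?_,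
    fun v => ?_⟩
  · have := hb a
    have := hP a
    have := hx (e a k)
    positivity
  · refine le_of_eq ?_
    have := (hP a).ne'
    rw [Finset.prod_div_distrib, Finset.prod_mul_distrib,
      Finset.prod_mul_distrib, Finset.prod_pow]
    simp only [Finset.prod_const, Finset.card_univ, Fintype.card_fin]
    field_simp
  · have h1 : ∑ a, ∑ k, (if e a k = v then b a * (∏ k, x (e a k)) / (m * x (e a k) ^ m) else 0) =
        (∑ a, b a * (∏ k, x (e a k)) * (∑ k, if e a k = v then 1 else 0)) / (m * x v ^ m) := by
      rw [Finset.sum_div]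
      refine Finset.sum_congr rfl fun a _ => ?_
      rw [Finset.mul_sum, Finset.sum_div]
      refine Finset.sum_congr rfl fun k _ => ?_
      split_ifs with hk
      · rw [hk, mul_one]
      · simp
    have hxp := hx v
    rw [h1, div_le_iff₀ (by positivity)]
    linarith [hxv v]

/-- A diagonal form which dominates a form with nonnegative coefficients on the positive orthant can
be distributed among the monomials of the latter so that each is dominated by its share. -/
theorem exists_weights {ι V : Type*} [Fintype ι] [Fintype V] [DecidableEq V] {m : ℕ}
    (hm : 0 < m) (d : V → ℝ) (b : ι → ℝ) (hb : ∀ a, 0 ≤ b a) (e : ι → Fin m → V)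
    (h : ∀ x : V → ℝ, (∀ v, 0 < x v) → ∑ a, b a * ∏ k, x (e a k) ≤ ∑ v, d v * x v ^ m) :
    ∃ c : ι → Fin m → ℝ, (∀ a k, 0 ≤ c a k) ∧ (∀ a, b a ^ m ≤ m ^ m * ∏ k, c a k) ∧
      ∀ v, ∑ a, ∑ k, (if e a k = v then c a k else 0) ≤ d v := by
  choose c hc0 hcb hcd using fun N : ℕ =>
    exists_weights_add hm d b hb e h (δ := 1 / ((N : ℝ) + 1)) (by positivity)
  -- Each weight is at most the total at its vertex, hence bounded uniformly for `δ ≤ 1`;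
  -- compactness allows `δ → 0`.
  set M : ℝ := ∑ v, |d v| + 1
  have hmem : ∀ N, c N ∈ Set.Icc (0 : ι → Fin m → ℝ) fun _ _ => M := by
    refine fun N => ⟨fun a k => hc0 N a k, fun a k => ?_⟩
    have hnn : ∀ a' k', 0 ≤ if e a' k' = e a k then c N a' k' else 0 := by
      intro a' k'
      split_ifs
      exacts [hc0 _ _ _, le_rfl]
    have h1 : c N a k ≤ ∑ k', if e a k' = e a k then c N a k' else 0 := by
      have := Finset.single_le_sum (f := fun k' => if e a k' = e a k then c N a k' else 0)
        (fun k' _ => hnn a k') (Finset.mem_univ k)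
      simpa using this
    have h2 := Finset.single_le_sum
      (f := fun a' => ∑ k', if e a' k' = e a k then c N a' k' else 0)
      (fun a' _ => Finset.sum_nonneg fun k' _ => hnn a' k') (Finset.mem_univ a)
    have h3 := hcd N (e a k)
    have h4 : |d (e a k)| ≤ ∑ v, |d v| :=
      Finset.single_le_sum (f := fun v => |d v|) (fun v _ => abs_nonneg _) (Finset.mem_univ _)
    have h5 := le_abs_self (d (e a k))
    have h6 : 1 / ((N : ℝ) + 1) ≤ 1 := by
      rw [div_le_one (by positivity)]
      linarith [(Nat.cast_nonneg N : (0 : ℝ) ≤ N)]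
    linarith
  obtain ⟨c', -, φ, hφ, hlim⟩ := isCompact_Icc.tendsto_subseq hmem
  have hlim' : ∀ a k, Filter.Tendsto (fun N => c (φ N) a k) Filter.atTop (nhds (c' a k)) :=
    fun a k => tendsto_pi_nhds.1 (tendsto_pi_nhds.1 hlim a) k
  refine ⟨c', fun a k => ge_of_tendsto' (hlim' a k) fun N => hc0 _ a k, fun a => ?_, fun v => ?_⟩
  · exact ge_of_tendsto' ((tendsto_finsetProd _ fun k _ => hlim' a k).const_mul _)
      fun N => hcb (φ N) a
  · have h1 : Filter.Tendsto (fun N => ∑ a, ∑ k, if e a k = v then c (φ N) a k else 0)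
        Filter.atTop (nhds (∑ a, ∑ k, if e a k = v then c' a k else 0)) := by
      refine tendsto_finsetSum _ fun a _ => tendsto_finsetSum _ fun k _ => ?_
      split_ifs
      exacts [hlim' a k, tendsto_const_nhds]
    have h2 : Filter.Tendsto (fun N => d v + 1 / ((φ N : ℝ) + 1)) Filter.atTop
        (nhds (d v + 0)) :=
      ((tendsto_one_div_add_atTop_nhds_zero_nat (𝕜 := ℝ)).comp hφ.tendsto_atTop).const_add _
    rw [add_zero] at h2
    exact le_of_tendsto_of_tendsto' h1 h2 fun N => hcd (φ N) v

/-! ### Retractions onto a block and removal of negative coefficients. -/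

/-- In a family of finite sets each of which meets the union of the preceding ones in at most one
point, every member is separated from the others: there is a map which is the identity on it and
constant on each of the others. -/
theorem exists_retraction {V : Type*} [DecidableEq V] [Nonempty V] {s : ℕ} (Γ : Fin s → Finset V)
    (h : ∀ p : Fin s, ((Finset.Iio p).biUnion Γ ∩ Γ p).card ≤ 1) (l : Fin s) :
    ∃ π : V → V, (∀ v ∈ Γ l, π v = v) ∧ ∀ q ≠ l, ∃ w, ∀ v ∈ Γ q, π v = w := by
  have hv : ∀ p : Fin s, ∃ z, ∀ v ∈ Γ p, ∀ q < p, v ∈ Γ q → v = z := by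
    intro p
    obtain ⟨z, hz⟩ : ∃ z, (Finset.Iio p).biUnion Γ ∩ Γ p ⊆ {z} :=
      Finset.card_le_one_iff_subset_singleton.1 (h p)
    refine ⟨z, fun v hvp q hq hvq => Finset.mem_singleton.1 (hz ?_)⟩
    exact Finset.mem_inter.2 ⟨Finset.mem_biUnion.2 ⟨q, Finset.mem_Iio.2 hq, hvq⟩, hvp⟩
  suffices H : ∀ p : ℕ, (l : ℕ) + 1 ≤ p → p ≤ s → ∃ π : V → V, (∀ v ∈ Γ l, π v = v) ∧
      ∀ q : Fin s, (q : ℕ) < p → q ≠ l → ∃ w, ∀ v ∈ Γ q, π v = w by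
    obtain ⟨π, h1, h2⟩ := H s l.2 le_rfl
    exact ⟨π, h1, fun q hq => h2 q q.2 hq⟩
  intro p hp
  induction p, hp using Nat.le_induction with
  | base =>
    intro _
    obtain ⟨z, hz⟩ := hv l
    classical
    -- All earlier sets collapse to `z`, the only point they can share with `Γ l`.
    refine ⟨fun v => if ∃ q < l, v ∈ Γ q then z else v, fun v hvl => ?_, fun q hq hql => ?_⟩
    · simp only
      split_ifs with hex
      · obtain ⟨q, hq, hvq⟩ := hex
        exact (hz v hvl q hq hvq).symm
      · rfl
    · have hlt : q < l := lt_of_le_of_ne (by rw [Fin.le_def]; omega) hql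
      exact ⟨z, fun v hvq => if_pos ⟨q, hlt, hvq⟩⟩
  | succ p hp ih =>
    intro hps
    obtain ⟨π, h1, h2⟩ := ih (by omega)
    set P : Fin s := ⟨p, hps⟩
    have hlP : l < P := by rw [Fin.lt_def]; exact hp
    obtain ⟨z, hz⟩ := hv P
    classical
    have hπ : ∀ q < P, ∀ v ∈ Γ q, (if v ∈ Γ P then π z else π v) = π v := by
      intro q hq v hvq
      split_ifs with hvP
      · rw [hz v hvP q hq hvq]
      · rfl
    -- The new set meets the earlier ones at most in `z`, so collapsing it to `π z` does not change
    -- `π` on them.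
    refine ⟨fun v => if v ∈ Γ P then π z else π v,
      fun v hvl => (hπ l hlP v hvl).trans (h1 v hvl), fun q hq hql => ?_⟩
    rcases Nat.lt_succ_iff_lt_or_eq.1 hq with hlt | heq
    · obtain ⟨w, hw⟩ := h2 q hlt hql
      exact ⟨w, fun v hvq => (hπ q hlt v hvq).trans (hw v hvq)⟩
    · obtain rfl : q = P := Fin.ext heq
      exact ⟨π z, fun v hvq => if_pos hvq⟩

/-- The function `R` is additive over the fibres of `π` and invariant under a change of sign on one
fibre. -/
structure IsFiberwise {V : Type*} [Fintype V] [DecidableEq V] (π : V → V) (R : (V → ℝ) → ℝ) :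
    Prop where
  neg_fiber : ∀ (w : V) (x : V → ℝ), R (fun v => if π v = w then -x v else x v) = R x
  sum_fiber : ∀ x : V → ℝ, ∑ w, R (fun v => if π v = w then x v else 0) = R x

namespace IsFiberwise

variable {V : Type*} [Fintype V] [DecidableEq V] {π : V → V}

theorem sum {ι : Type*} (s : Finset ι) {R : ι → (V → ℝ) → ℝ}
    (h : ∀ a ∈ s, IsFiberwise π (R a)) : IsFiberwise π fun x => ∑ a ∈ s, R a x where
  neg_fiber w x := Finset.sum_congr rfl fun a ha => (h a ha).neg_fiber w x
  sum_fiber x := by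
    rw [Finset.sum_comm]
    exact Finset.sum_congr rfl fun a ha => (h a ha).sum_fiber x

theorem sub {R S : (V → ℝ) → ℝ} (hR : IsFiberwise π R) (hS : IsFiberwise π S) :
    IsFiberwise π fun x => R x - S x where
  neg_fiber w x := by rw [hR.neg_fiber, hS.neg_fiber]
  sum_fiber x := by rw [Finset.sum_sub_distrib, hR.sum_fiber, hS.sum_fiber]

theorem monomial {m : ℕ} (hm0 : 0 < m) (hm : Even m) (c : ℝ) (i : Fin m → V) (w₀ : V)
    (hi : ∀ k, π (i k) = w₀) : IsFiberwise π fun x => c * ∏ k, x (i k) where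
  neg_fiber w x := by
    simp only [hi]
    split_ifs
    · simp [Finset.prod_neg, hm.neg_one_pow]
    · rfl
  sum_fiber x := by
    rw [Finset.sum_eq_single w₀]
    · simp [hi]
    · intro w _ hw
      have : (∏ k, if π (i k) = w then x (i k) else 0) = 0 :=
        Finset.prod_eq_zero (Finset.mem_univ ⟨0, hm0⟩) (by simp [hi, hw.symm])
      rw [this, mul_zero]
    · simp

theorem diagonal {m : ℕ} (hm0 : 0 < m) (hm : Even m) (d : V → ℝ) :
    IsFiberwise π fun x => ∑ v, d v * x v ^ m :=
  sum _ fun v _ => by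
    simpa using monomial hm0 hm (d v) (fun _ => v) (π v) (fun _ => rfl)

end IsFiberwise

/-- The coefficient `β'` is a nonnegative substitute for the coefficient `β` of the monomial with
multi-index `i`. -/
structure IsMajorant {m : ℕ} {U : Type*} [DecidableEq U] (i : Fin m → U) (β β' : ℝ) : Prop where
  nonneg : 0 ≤ β'
  abs_le_or_even : |β| ≤ β' ∨ β ≤ 0 ∧ ∀ v, Even (Finset.univ.filter fun k => i k = v).card

/-- One mixed term `β x^i`, whose variables are separated by `π`, may be replaced by a term with a
nonnegative coefficient. -/
theorem exists_isMajorant_of_isFiberwise {V : Type*} [Fintype V] [DecidableEq V] {π : V → V}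
    {R : (V → ℝ) → ℝ} (hR : IsFiberwise π R) {m : ℕ} {Γ : Finset V}
    (hπ : ∀ v ∈ Γ, π v = v) (i : Fin m → Γ) (hi : RealTensor.OffDiag i) (hm0 : 0 < m) (β : ℝ)
    (h : ∀ x, 0 ≤ R x - β * ∏ k, x (i k)) :
    ∃ β', IsMajorant i β β' ∧ ∀ x, 0 ≤ R x - β' * ∏ k, x (i k) := by
  have hπi : ∀ k, π (i k) = i k := fun k => hπ _ (i k).2
  rcases le_total 0 β with hβ | hβ
  · exact ⟨β, ⟨hβ, Or.inl (abs_of_nonneg hβ).le⟩, h⟩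
  by_cases hev : ∀ v, Even (Finset.univ.filter fun k => i k = v).card
  -- On vectors supported in one fibre the monomial vanishes, since its distinct variables lie in
  -- distinct fibres. So `R` is nonnegative there, hence everywhere by additivity.
  · refine ⟨0, ⟨le_rfl, Or.inr ⟨hβ, hev⟩⟩, fun x => ?_⟩
    rw [zero_mul, sub_zero, ← hR.sum_fiber x]
    refine Finset.sum_nonneg fun w _ => ?_
    have hw : ∃ k, (i k : V) ≠ w := by
      by_contra! hcon
      exact hi ⟨i ⟨0, hm0⟩, fun k => Subtype.ext ((hcon k).trans (hcon _).symm)⟩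
    obtain ⟨k, hk⟩ := hw
    have h0 := h fun v => if π v = w then x v else 0
    rwa [Finset.prod_eq_zero (Finset.mem_univ k) (by simp [hπi, hk]), mul_zero, sub_zero] at h0
  · push Not at hev
    obtain ⟨v, hv⟩ := hev
    -- In `Γ` only `v` lies in its fibre, so flipping that fibre changes the sign of the monomial,
    -- whose exponent at `v` is odd, but not `R`.
    refine ⟨-β, ⟨by linarith, Or.inl (abs_of_nonpos hβ).le⟩, fun x => ?_⟩
    have h0 := h fun u => if π u = v then -x u else x u
    rw [hR.neg_fiber] at h0
    have hprod : (∏ k, if π (i k) = v then -x (i k) else x (i k)) = -∏ k, x (i k) := by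
      have : ∀ k, (if π (i k) = v then -x (i k) else x (i k)) =
          (if i k = v then -1 else 1) * x (i k) := by
        intro k
        rw [hπi]
        simp only [Subtype.coe_inj]
        split_ifs <;> ring
      simp only [this, Finset.prod_mul_distrib, Finset.prod_ite, Finset.prod_const, one_pow,
        mul_one, (Nat.not_even_iff_odd.1 hv).neg_one_pow, neg_mul, one_mul]
    rw [hprod] at h0
    linarith

theorem isSumSq_prod_of_even {R U : Type*} [CommRing R] [Fintype U] [DecidableEq U] {m : ℕ}
    (i : Fin m → U) (X : U → R)
    (h : ∀ v, Even (Finset.univ.filter fun k => i k = v).card) : IsSumSq (∏ k, X (i k)) := by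
  have : ∏ k, X (i k) = ∏ v, X v ^ (Finset.univ.filter fun k => i k = v).card := by
    rw [← Finset.prod_fiberwise' Finset.univ i X]
    exact Finset.prod_congr rfl fun v _ => by rw [Finset.prod_const]
  rw [this]
  refine IsSumSq.prod fun v _ => ?_
  obtain ⟨r, hr⟩ := h v
  rw [hr, pow_add]
  exact IsSumSq.mul_self _

/-- Block by block, the mixed terms may be replaced by terms with nonnegative coefficients. -/
theorem exists_isMajorant {V : Type*} [Fintype V] [DecidableEq V] [Nonempty V] {m s : ℕ}
    (hm0 : 0 < m) (hm : Even m) (Γ : Fin s → Finset V)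
    (hΓ : ∀ p : Fin s, ((Finset.Iio p).biUnion Γ ∩ Γ p).card ≤ 1) (d : V → ℝ)
    (b : (l : Fin s) → (Fin m → Γ l) → ℝ)
    (hb : ∀ l, (∃ j, RealTensor.OffDiag j ∧ ∀ i ≠ j, b l i = 0) ∨ ∀ i, 0 ≤ b l i)
    (h : ∀ x : V → ℝ, 0 ≤ ∑ v, d v * x v ^ m - ∑ l, ∑ i, b l i * ∏ k, x (i k)) :
    ∃ b' : (l : Fin s) → (Fin m → Γ l) → ℝ, (∀ l i, IsMajorant i (b l i) (b' l i)) ∧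
      ∀ x : V → ℝ, 0 ≤ ∑ v, d v * x v ^ m - ∑ l, ∑ i, b' l i * ∏ k, x (i k) := by
  suffices H : ∀ S : Finset (Fin s), ∃ b' : (l : Fin s) → (Fin m → Γ l) → ℝ,
      (∀ l ∈ S, ∀ i, IsMajorant i (b l i) (b' l i)) ∧ (∀ l ∉ S, b' l = b l) ∧
      ∀ x : V → ℝ, 0 ≤ ∑ v, d v * x v ^ m - ∑ l, ∑ i, b' l i * ∏ k, x (i k) by
    obtain ⟨b', h1, -, h2⟩ := H Finset.univ
    exact ⟨b', fun l => h1 l (Finset.mem_univ l), h2⟩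
  intro S
  induction S using Finset.induction_on with
  | empty => exact ⟨b, by simp, by simp, h⟩
  | insert l S hl ih =>
    obtain ⟨b', h1, h2, h3⟩ := ih
    rcases hb l with ⟨j, hj, hjb⟩ | hpos
    · obtain ⟨π, hπ, hπq⟩ := exists_retraction Γ hΓ l
      -- This holds whatever the current coefficients `b'` of the other blocks, so blocks can be
      -- treated one after another.
      have hfib : IsFiberwise π fun x => ∑ v, d v * x v ^ m -
          ∑ q ∈ Finset.univ.erase l, ∑ i, b' q i * ∏ k, x (i k) := by
        refine (IsFiberwise.diagonal hm0 hm d).sub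
          (IsFiberwise.sum _ fun q hq => IsFiberwise.sum _ fun i _ => ?_)
        obtain ⟨w, hw⟩ := hπq q (Finset.ne_of_mem_erase hq)
        exact IsFiberwise.monomial hm0 hm _ (fun k => (i k : V)) w fun k => hw _ (i k).2
      have hsplit : ∀ (c : (l : Fin s) → (Fin m → Γ l) → ℝ) (x : V → ℝ),
          (∀ q ≠ l, c q = b' q) → (∀ i ≠ j, c l i = 0) →
          ∑ l, ∑ i, c l i * ∏ k, x (i k) = c l j * ∏ k, x (j k) +
            ∑ q ∈ Finset.univ.erase l, ∑ i, b' q i * ∏ k, x (i k) := by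
        intro c x hc hcj
        rw [← Finset.add_sum_erase _ _ (Finset.mem_univ l)]
        congr 1
        · exact Finset.sum_eq_single j (fun i _ hij => by rw [hcj i hij, zero_mul]) (by simp)
        · exact Finset.sum_congr rfl fun q hq => by rw [hc q (Finset.ne_of_mem_erase hq)]
      obtain ⟨β', hβ', hx⟩ := exists_isMajorant_of_isFiberwise hfib hπ j hj hm0 (b l j) (by
        intro x
        have := h3 x
        rw [hsplit b' x (fun _ _ => rfl) (by rwa [h2 l hl]), h2 l hl] at this
        linarith)
      refine ⟨Function.update b' l (Pi.single j β'), ?_, ?_, ?_⟩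
      · intro q hq i
        by_cases hql : q = l
        · subst hql
          rw [Function.update_self]
          by_cases hij : i = j
          · subst hij
            rwa [Pi.single_eq_same]
          · rw [Pi.single_eq_of_ne hij, hjb i hij]
            exact ⟨le_rfl, Or.inl (by simp)⟩
        · rw [Function.update_of_ne hql]
          exact h1 q (Finset.mem_of_mem_insert_of_ne hq hql) i
      · intro q hq
        rw [Finset.mem_insert, not_or] at hq
        rw [Function.update_of_ne hq.1, h2 q hq.2]
      · intro x
        rw [hsplit _ x (fun q hq => Function.update_of_ne hq _ _)
          (fun i hi => by rw [Function.update_self, Pi.single_eq_of_ne hi]),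
          Function.update_self, Pi.single_eq_same]
        linarith [hx x]
    · refine ⟨b', fun q hq i => ?_, fun q hq => h2 q fun hqS => hq (Finset.mem_insert_of_mem hqS),
        h3⟩
      rcases Finset.mem_insert.1 hq with rfl | hqS
      · rw [h2 q hl]
        exact ⟨hpos i, Or.inl (abs_of_nonneg (hpos i)).le⟩
      · exact h1 q hqS i

/-! ### From tensors to polynomials, and assembly of the blocks. -/

open MvPolynomial in
/-- The block written as a diagonal part and a combination of mixed terms, where only one mixed
term is left when all of them are multiples of a single monomial. -/
theorem exists_neg_form_eq {m : ℕ} {U : Type*} [Fintype U] [DecidableEq U] (hm : 0 < m)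
    (B : RealTensor m U) (hB : B.HasSingleMixedTerm ∨ B.IsEssentiallyNonneg) :
    ∃ (D : U → ℝ) (b : (Fin m → U) → ℝ),
      -B.form = ∑ v, C (D v) * X v ^ m - ∑ i, C (b i) * ∏ k, X (i k) ∧
      ((∃ j, RealTensor.OffDiag j ∧ ∀ i ≠ j, b i = 0) ∨ ∀ i, 0 ≤ b i) := by
  classical
  set o : (Fin m → U) → ℝ := fun i => if RealTensor.OffDiag i then B i else 0
  have hsplit : -B.form = ∑ v, C (-B fun _ => v) * X v ^ m - ∑ i, C (o i) * ∏ k, X (i k) := by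
    have h1 : ∑ i : Fin m → U, C (if RealTensor.OffDiag i then 0 else B i) *
        ∏ k, (X (i k) : MvPolynomial U ℝ) = ∑ v, C (B fun _ => v) * X v ^ m := by
      have hinj : Function.Injective fun (v : U) (_ : Fin m) => v :=
        fun v w h => congrFun h ⟨0, hm⟩
      symm
      refine Finset.sum_of_injOn (fun v _ => v) hinj.injOn (by simp) ?_ ?_
      · intro i _ hi
        rw [if_pos, C_0, zero_mul]
        rintro ⟨a, ha⟩
        exact hi ⟨a, by simp, funext fun k => (ha k).symm⟩
      · intro v _
        rw [if_neg (fun h => h ⟨v, fun _ => rfl⟩)]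
        simp
    have h2 : B.form = ∑ i : Fin m → U, C (if RealTensor.OffDiag i then 0 else B i) *
        ∏ k, (X (i k) : MvPolynomial U ℝ) + ∑ i, C (o i) * ∏ k, X (i k) := by
      rw [RealTensor.form, ← Finset.sum_add_distrib]
      refine Finset.sum_congr rfl fun i _ => ?_
      rw [← add_mul, ← C_add]
      congr 2
      simp only [o]
      split_ifs <;> simp
    rw [h2, h1]
    simp only [C_neg, neg_mul, Finset.sum_neg_distrib]
    ring
  rcases hB with ⟨j, hj, hjB⟩ | hpos
  -- Permutations of `j` give the same monomial, so their coefficients are added up at `j`; `B`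
  -- itself need not be symmetric.
  · refine ⟨fun v => -B fun _ => v, Pi.single j (∑ i, o i), hsplit.trans ?_, Or.inl ⟨j, hj, fun i hi =>
      Pi.single_eq_of_ne hi _⟩⟩
    congr 1
    symm
    rw [Finset.sum_eq_single j (fun i _ hi => by rw [Pi.single_eq_of_ne hi, C_0, zero_mul])
      (by simp), Pi.single_eq_same, map_sum, Finset.sum_mul]
    refine Finset.sum_congr rfl fun i _ => ?_
    by_cases hi : RealTensor.OffDiag i ∧ ∃ σ : Equiv.Perm (Fin m), i = j ∘ σ
    · obtain ⟨σ, rfl⟩ := hi.2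
      congr 1
      exact (Equiv.prod_comp σ fun k => (X (j k) : MvPolynomial U ℝ)).symm
    · have : o i = 0 := by
        simp only [o]
        split_ifs with ho
        · exact hjB i ho fun hσ => hi ⟨ho, hσ⟩
        · rfl
      simp [this]
  · refine ⟨_, o, hsplit, Or.inr fun i => ?_⟩
    simp only [o]
    split_ifs with ho
    exacts [hpos i ho, le_rfl]

-- Weights found for the substitute `β'` also serve the original `β`: either `|β| ≤ β'`, or `-β`
-- times the monomial is already a sum of squares.
open MvPolynomial in
theorem isSumSq_sub_of_isMajorant {m : ℕ} {U : Type*} [Fintype U] [DecidableEq U] (hm0 : 0 < m)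
    (hm : Even m) (i : Fin m → U) {β β' : ℝ} (h : IsMajorant i β β') (c : Fin m → ℝ)
    (hc : ∀ k, 0 ≤ c k) (hb : β' ^ m ≤ m ^ m * ∏ k, c k) :
    IsSumSq (∑ k, C (c k) * X (i k) ^ m - C β * ∏ k, X (i k) : MvPolynomial U ℝ) := by
  rcases h.abs_le_or_even with hβ | ⟨hβ, hev⟩
  · refine (isSumSq_sum_mul_pow_add_mul_prod hm0 hm (fun k => (X (i k) : MvPolynomial U ℝ)) c hc
      (-β) ?_).of_eq ?_
    · rw [abs_neg]
      exact (pow_le_pow_left₀ (abs_nonneg _) hβ m).trans hb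
    · simp [algebraMap_eq, sub_eq_add_neg]
  · refine ((isSumSq_sum_mul_pow_add_mul_prod hm0 hm (fun k => (X (i k) : MvPolynomial U ℝ)) c hc
      0 ?_).add ((isSumSq_prod_of_even i X hev).algebraMap_mul (-β) (by linarith))).of_eq ?_
    · rw [abs_zero, zero_pow hm0.ne']
      exact mul_nonneg (by positivity) (Finset.prod_nonneg fun k _ => hc k)
    · simp [algebraMap_eq, sub_eq_add_neg]

theorem theorem3p1 {m n s : ℕ} (hm : 0 < m) (hm_even : Even m)
    (A : RealTensor m (Fin n)) (hA : A.IsSymmetric)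
    (Γ : Fin s → Finset (Fin n)) (B : (l : Fin s) → RealTensor m (Γ l))
    (hW : RealTensor.IsWTensorWith A Γ B)
    (f : MvPolynomial (Fin n) ℝ) (hf : f = -A.form)
    (hf_nonneg : ∀ x : Fin n → ℝ, 0 ≤ MvPolynomial.eval x f) :
    ∃ (h : (l : Fin s) → MvPolynomial (Γ l) ℝ) (ρ : Fin s → Fin n → ℝ),
      (∀ l : Fin s, IsSumSq (h l)) ∧
      (∀ l : Fin s, h l = -(B l).form +
        ∑ i : Γ l, MvPolynomial.C (ρ l i) * MvPolynomial.X i ^ m) ∧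
      (∀ i : Fin n, ∑ l : Fin s with i ∈ Γ l, ρ l i = 0) ∧
      f = ∑ l : Fin s, MvPolynomial.rename (Subtype.val : Γ l → Fin n) (h l) := by
  have : Nonempty (Fin n) := ⟨⟨0, hW.one_le.trans hW.le_dim⟩⟩
  choose D₀ b hform hb using fun l => exists_neg_form_eq hm (B l) (hW.block l)
  set D : Fin s → Fin n → ℝ := fun l v => if hv : v ∈ Γ l then D₀ l ⟨v, hv⟩ else 0 with hD
  have hD₀ : ∀ l (v : Γ l), D l v = D₀ l v := fun l v => by simp [hD]
  have hDout : ∀ l v, v ∉ Γ l → D l v = 0 := fun l v hv => by simp [hD, hv]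
  have hDsum : ∀ (l : Fin s) (E : Fin n → ℝ) (x : Fin n → ℝ), (∀ v ∉ Γ l, E v = 0) →
      ∑ v : Γ l, E v * x v ^ m = ∑ v, E v * x v ^ m := by
    intro l E x hE
    rw [Finset.sum_coe_sort (Γ l) fun v => E v * x v ^ m]
    exact Finset.sum_subset (Finset.subset_univ _) fun v _ hv => by rw [hE v hv, zero_mul]
  set d : Fin n → ℝ := fun v => ∑ l, D l v
  have hfx : ∀ x : Fin n → ℝ, MvPolynomial.eval x f =
      ∑ v, d v * x v ^ m - ∑ l, ∑ i, b l i * ∏ k, x (i k) := by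
    intro x
    rw [hf, map_neg, hW.decomp x, ← Finset.sum_neg_distrib]
    have : ∀ l, -MvPolynomial.eval (fun i : Γ l => x i) (B l).form =
        ∑ v, D l v * x v ^ m - ∑ i, b l i * ∏ k, x (i k) := by
      intro l
      rw [← map_neg, hform, ← hDsum l (D l) x (hDout l)]
      simp [hD₀]
    simp only [this, Finset.sum_sub_distrib, d, Finset.sum_mul]
    rw [Finset.sum_comm]
  obtain ⟨b', hbb', hb'⟩ := exists_isMajorant hm hm_even Γ hW.inter_le_one d b hb
    fun x => (hfx x).symm ▸ hf_nonneg x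
  -- The monomials of all blocks share the pooled diagonal `d`, because the diagonal of a single
  -- block need not suffice for it.
  obtain ⟨c, hc0, hcb, hcd⟩ := exists_weights hm d
    (fun a : (l : Fin s) × (Fin m → Γ l) => b' a.1 a.2) (fun a => (hbb' a.1 a.2).nonneg)
    (fun a k => (a.2 k : Fin n)) (fun x _ => by
      rw [Fintype.sum_sigma]
      exact sub_nonneg.1 (hb' x))
  set w : Fin s → Fin n → ℝ := fun l v =>
    ∑ i : Fin m → Γ l, ∑ k, if (i k : Fin n) = v then c ⟨l, i⟩ k else 0 with hw
  have hwd : ∀ v, ∑ l, w l v ≤ d v := fun v => by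
    have := hcd v
    rwa [Fintype.sum_sigma] at this
  have hwout : ∀ l v, v ∉ Γ l → w l v = 0 := fun l v hv =>
    Finset.sum_eq_zero fun i _ => Finset.sum_eq_zero fun k _ =>
      if_neg fun h : (i k : Fin n) = v => hv (h ▸ (i k).2)
  choose l₀ hl₀ using hW.cover
  -- The unused diagonal mass at `v` goes to one chosen block containing `v`, so that the `ρ` sum to
  -- exactly zero.
  set r : Fin s → Fin n → ℝ := fun l v => if l = l₀ v then d v - ∑ q, w q v else 0 with hr
  have hr0 : ∀ l v, 0 ≤ r l v := fun l v => by
    simp only [hr]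
    split_ifs
    exacts [sub_nonneg.2 (hwd v), le_rfl]
  have hrout : ∀ l v, v ∉ Γ l → r l v = 0 := fun l v hv =>
    if_neg fun h : l = l₀ v => hv (h ▸ hl₀ v)
  set ρ : Fin s → Fin n → ℝ := fun l v => w l v + r l v - D l v with hρ
  have hρout : ∀ l v, v ∉ Γ l → ρ l v = 0 := fun l v hv => by
    simp only [hρ, hwout l v hv, hrout l v hv, hDout l v hv]
    ring
  have hρsum : ∀ v, ∑ l, ρ l v = 0 := fun v => by
    simp only [hρ, hr, Finset.sum_sub_distrib, Finset.sum_add_distrib, Finset.sum_ite_eq',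
      Finset.mem_univ, if_true, d]
    ring
  refine ⟨fun l => -(B l).form + ∑ i : Γ l, MvPolynomial.C (ρ l i) * MvPolynomial.X i ^ m, ρ,
    fun l => ?_, fun l => rfl, fun v => ?_, ?_⟩
  · have h1 : IsSumSq (∑ v : Γ l, MvPolynomial.C (r l v) * MvPolynomial.X v ^ m :
        MvPolynomial (Γ l) ℝ) := IsSumSq.sum fun v _ => by
      obtain ⟨p, hp⟩ := hm_even
      rw [hp, pow_add]
      exact (IsSumSq.mul_self _).algebraMap_mul _ (hr0 l v)
    have h2 : IsSumSq (∑ i : Fin m → Γ l, (∑ k, MvPolynomial.C (c ⟨l, i⟩ k) *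
        MvPolynomial.X (i k) ^ m - MvPolynomial.C (b l i) * ∏ k, MvPolynomial.X (i k)) :
        MvPolynomial (Γ l) ℝ) := IsSumSq.sum fun i _ =>
      isSumSq_sub_of_isMajorant hm hm_even i (hbb' l i) _ (hc0 _) (hcb ⟨l, i⟩)
    have h3 : ∑ v : Γ l, MvPolynomial.C (w l v) * MvPolynomial.X v ^ m =
        ∑ i : Fin m → Γ l, ∑ k, MvPolynomial.C (c ⟨l, i⟩ k) *
          (MvPolynomial.X (i k) : MvPolynomial (Γ l) ℝ) ^ m := by
      simp only [hw, map_sum, Finset.sum_mul]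
      rw [Finset.sum_comm]
      refine Finset.sum_congr rfl fun i _ => ?_
      rw [Finset.sum_comm]
      refine Finset.sum_congr rfl fun k _ => ?_
      rw [Finset.sum_eq_single (i k)]
      · simp
      · intro v _ hv
        rw [if_neg fun h => hv (Subtype.ext h.symm), MvPolynomial.C_0, zero_mul]
      · simp
    refine (h1.add h2).of_eq ?_
    beta_reduce
    rw [hform l, Finset.sum_sub_distrib, ← h3]
    simp only [hρ, hD₀, MvPolynomial.C_sub, MvPolynomial.C_add, sub_mul, add_mul,
      Finset.sum_sub_distrib, Finset.sum_add_distrib]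
    ring
  · rw [← hρsum v]
    exact Finset.sum_subset (Finset.filter_subset _ _) fun l _ hl =>
      hρout l v fun hv => hl (by simp [hv])
  -- The decomposition of `A` is given only pointwise, so the identity is checked on evaluations.
  · refine MvPolynomial.funext fun x => ?_
    have hzero : ∑ l, ∑ v : Γ l, ρ l v * x v ^ m = 0 := by
      rw [Finset.sum_congr rfl fun l _ => hDsum l (ρ l) x (hρout l), Finset.sum_comm]
      exact Finset.sum_eq_zero fun v _ => by rw [← Finset.sum_mul, hρsum, zero_mul]
    rw [hf, map_neg, hW.decomp x, map_sum, ← Finset.sum_neg_distrib]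
    simp only [MvPolynomial.eval_rename, map_add, map_neg, map_sum, map_mul, map_pow,
      MvPolynomial.eval_C, MvPolynomial.eval_X, Finset.sum_add_distrib, Function.comp_apply,
      hzero, add_zero]
    rfl
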